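/- Let $K\ge 2$ and $\sigma>0$. Consider the stochastic $K$-armed bandit with Gaussian noise: for a mean vector $\theta\in[0,1]^K$, in each round $t=1,2,\dots$ an arm $a_t\in\{1,\dots,K\}$ is pulled and a reward $\theta_{a_t}+\epsilon_t$ is observed, where the $\epsilon_t\sim\mathcal N(0,\sigma^2)$ are independent noises, each independent of the past and of the chosen arm. An any-time policy (no knowledge of the horizon) maps, for every $t$, the history of the first $t-1$ rounds to a probability distribution on the arms from which $a_t$ is drawn. A fixed-time policy (knowledge of the horizon) is a family $\pi=(\pi(T))_{T}$ of such policies, where $\pi(T)$ is executed when the horizon is $T$; an any-time policy is identified with the constant family. The pseudo regret over horizon $T$ is $R^\pi_\theta(T)=\sum_{k=1}^K n_k\Delta_k$, where $n_k$ is the number of pulls of arm $k$ in the first $T$ rounds and $\Delta_k=\max_j\theta_j-\theta_k$. Suprema over $\theta$ are over $[0,1]^K$, and $\ln 0=-\infty$. A policy $\pi$ is * $\alpha$-optimal if $\limsup_{T\to\infty}\sup_\theta\mathbb E[R^\pi_\theta(T)]/T^{\alpha'}=0$ for every $\alpha'>\alpha$; * $\beta$-consistent if $\limsup_{T\to\infty}\mathbb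 E[R^\pi_\theta(T)]/T^{\beta'}=0$ for every $\theta\in[0,1]^K$ and every $\beta'>\beta$; * worst-case $(\delta,\gamma)$-tailed if there are $c\in(0,1/2)$ and $C>0$ with $\limsup_{T\to\infty}T^{-\gamma}\ln\sup_\theta\mathbb P(R^\pi_\theta(T)>cT^\delta)\le -C$; * instance-dependent $(\delta,\gamma)$-tailed if for every $\theta\in[0,1]^K$ there are $c\in(0,1/2)$ and $C>0$ with $\limsup_{T\to\infty}T^{-\gamma}\ln\mathbb P(R^\pi_\theta(T)>cT^\delta)\le -C$. **Theorem.** Fix $\alpha\in[1/2,1)$ and $\beta\in[0,1)$. 1. If a fixed-time policy $\pi$ is both $\alpha$-optimal and $\beta$-consistent, then $\pi$ is not worst-case $(\delta,\gamma)$-tailed for any $\delta\in(\alpha,1]$ and $\gamma>\min\{\delta+\alpha-1,\beta\}$, and $\pi$ is not instance-dependent $(\delta,\gamma)$-tailed for any $\delta\in(\beta,1]$ and $\gamma>\beta$. 2. If an any-time policy $\pi$ is both $\alpha$-optimal and $\beta$-consistent, then $\pi$ is not worst-case $(\delta,\gamma)$-tailed for any $\delta\in(\alpha,1]$ and $\gamma>\min\{\delta+\alpha-1,\delta\beta\}$,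 and $\pi$ is not instance-dependent $(\delta,\gamma)$-tailed for any $\delta\in(\beta,1]$ and $\gamma>\delta\beta$. -/

import Mathlib

open MeasureTheory ProbabilityTheory Filter
open scoped ENNReal NNReal

noncomputable section

namespace Bandit

/-- The history after `t` rounds: the sequence of (pulled arm, received reward) pairs. -/
abbrev History (K t : ℕ) : Type := Fin t → Fin K × ℝ

/-- A randomized non-anticipating policy that does not depend on the horizon. After any `t` rounds,
the history of these rounds is mapped to a probability distribution on the arms, from which the
arm of the next round is drawn. -/
structure AnyTimePolicy (K : ℕ) where
  act : (t : ℕ) → Kernel (History K t) (Fin K)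
  isMarkov : ∀ t, IsMarkovKernel (act t)

/-- A policy that knows the horizon: a sub-policy `π T` for every horizon `T`. -/
abbrev FixedTimePolicy (K : ℕ) : Type := ℕ → AnyTimePolicy K

/-- An any-time policy is the fixed-time policy with the same sub-policy for all horizons. -/
def AnyTimePolicy.toFixedTime {K : ℕ} (π : AnyTimePolicy K) : FixedTimePolicy K := fun _ => π

variable {K : ℕ}

instance (π : AnyTimePolicy K) (t : ℕ) : IsMarkovKernel (π.act t) := π.isMarkov t

/-- The reward of arm `a` is `θ a + ε` with noise `ε` of law `N(0, σ²)`, so its law is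
`N(θ a, σ²)`. -/
def rewardKernel (σ : ℝ≥0) (θ : Fin K → ℝ) : Kernel (Fin K) ℝ where
  toFun a := gaussianReal (θ a) (σ ^ 2)
  measurable' := measurable_from_top

instance (σ : ℝ≥0) (θ : Fin K → ℝ) : IsMarkovKernel (rewardKernel σ θ) :=
  ⟨fun a => inferInstanceAs (IsProbabilityMeasure (gaussianReal (θ a) (σ ^ 2)))⟩

/-- One round: draw an arm from the policy given the history, then a reward of that arm that
depends on the past only through the arm. -/
def roundKernel (σ : ℝ≥0) (θ : Fin K → ℝ) (π : AnyTimePolicy K) (t : ℕ) :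
    Kernel (History K t) (Fin K × ℝ) :=
  π.act t ⊗ₖ (rewardKernel σ θ).prodMkLeft (History K t)

instance (σ : ℝ≥0) (θ : Fin K → ℝ) (π : AnyTimePolicy K) (t : ℕ) :
    IsMarkovKernel (roundKernel σ θ π t) := by
  unfold roundKernel; infer_instance

/-- The law of the history after `t` rounds under the mean vector `θ` and the policy `π`. -/
def historyLaw (σ : ℝ≥0) (θ : Fin K → ℝ) (π : AnyTimePolicy K) :
    (t : ℕ) → Measure (History K t)
  | 0 => Measure.dirac Fin.elim0
  | t + 1 => (historyLaw σ θ π t ⊗ₘ roundKernel σ θ π t).map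
      fun p => (Fin.snoc p.1 p.2 : History K (t + 1))

lemma measurable_snoc (t : ℕ) :
    Measurable fun p : History K t × (Fin K × ℝ) => (Fin.snoc p.1 p.2 : History K (t + 1)) := by
  refine measurable_pi_lambda _ fun i => ?_
  refine Fin.lastCases ?_ (fun j => ?_) i
  · simpa using measurable_snd
  · simpa [Function.comp_def] using
      (measurable_pi_apply j).comp (measurable_fst (α := History K t) (β := Fin K × ℝ))

instance (σ : ℝ≥0) (θ : Fin K → ℝ) (π : AnyTimePolicy K) (t : ℕ) :
    IsProbabilityMeasure (historyLaw σ θ π t) := by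
  induction t with
  | zero => unfold historyLaw; infer_instance
  | succ t ih =>
    unfold historyLaw
    exact Measure.isProbabilityMeasure_map (measurable_snoc t).aemeasurable

/-- The number of pulls of arm `k` in the history `h`. -/
def pulls {T : ℕ} (h : History K T) (k : Fin K) : ℕ :=
  (Finset.univ.filter fun t => (h t).1 = k).card

/-- The gap `max_j θ_j - θ_k`. -/
def gap (θ : Fin K → ℝ) (k : Fin K) : ℝ := (⨆ j, θ j) - θ k

/-- The pseudo regret `∑_k n_k Δ_k`. -/
def pseudoRegret (θ : Fin K → ℝ) {T : ℕ} (h : History K T) : ℝ :=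
  ∑ k, (pulls h k : ℝ) * gap θ k

/-- The admissible mean vectors, `[0, 1]^K`. -/
def meanVectors (K : ℕ) : Set (Fin K → ℝ) := Set.Icc 0 1

/-- The expected pseudo regret over the horizon `T`. -/
def expectedRegret (σ : ℝ≥0) (θ : Fin K → ℝ) (π : FixedTimePolicy K) (T : ℕ) : ℝ≥0∞ :=
  ∫⁻ h, ENNReal.ofReal (pseudoRegret θ h) ∂(historyLaw σ θ (π T) T)

/-- The probability that the pseudo regret over the horizon `T` is larger than `x`. -/
def tailProb (σ : ℝ≥0) (θ : Fin K → ℝ) (π : FixedTimePolicy K) (T : ℕ) (x : ℝ) : ℝ≥0∞ :=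
  historyLaw σ θ (π T) T {h | x < pseudoRegret θ h}

/-- Worst-case `α`-optimality. -/
def IsOptimal (σ : ℝ≥0) (π : FixedTimePolicy K) (α : ℝ) : Prop :=
  ∀ α' : ℝ, α < α' →
    limsup (fun T : ℕ => (⨆ θ ∈ meanVectors K, expectedRegret σ θ π T) / (T : ℝ≥0∞) ^ α') atTop = 0

/-- Instance-dependent `β`-consistency. -/
def IsConsistent (σ : ℝ≥0) (π : FixedTimePolicy K) (β : ℝ) : Prop :=
  ∀ θ ∈ meanVectors K, ∀ β' : ℝ, β < β' →
    limsup (fun T : ℕ => expectedRegret σ θ π T / (T : ℝ≥0∞) ^ β') atTop = 0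

/-- The worst-case `(δ, γ)`-tail property; `ENNReal.log` has the value `⊥` (that is, `-∞`)
at `0`. -/
def IsWorstCaseTailed (σ : ℝ≥0) (π : FixedTimePolicy K) (δ γ : ℝ) : Prop :=
  ∃ c C : ℝ, 0 < c ∧ c < 1 / 2 ∧ 0 < C ∧
    limsup (fun T : ℕ =>
      ENNReal.log (⨆ θ ∈ meanVectors K, tailProb σ θ π T (c * (T : ℝ) ^ δ)) /
        (((T : ℝ) ^ γ : ℝ) : EReal)) atTop ≤ ((-C : ℝ) : EReal)

/-- The instance-dependent `(δ, γ)`-tail property; the constants may depend on `θ`. -/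
def IsInstanceTailed (σ : ℝ≥0) (π : FixedTimePolicy K) (δ γ : ℝ) : Prop :=
  ∀ θ ∈ meanVectors K, ∃ c C : ℝ, 0 < c ∧ c < 1 / 2 ∧ 0 < C ∧
    limsup (fun T : ℕ =>
      ENNReal.log (tailProb σ θ π T (c * (T : ℝ) ^ δ)) /
        (((T : ℝ) ^ γ : ℝ) : EReal)) atTop ≤ ((-C : ℝ) : EReal)

end Bandit

end

namespace Bandit

variable {K : ℕ}

/-! ### Integration against the law of the history -/

/-! Two instances are compared: in the first, arm `a` has mean `Δ` and all others `0`; in the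
second, arm `b` is raised to `2Δ`. Small expected regret in the first forces, by Markov, at most `M`
pulls of `b` with probability at least 1/2. By a change of measure (`sq_historyLaw_le`) the same
event has probability at least `exp (-4MΔ²/σ²) / 4` in the second, where it means regret at least
`(S - M)Δ` by time `S`. This is `le_historyLaw_lt_pseudoRegret`; the rest is the choice of
parameters.

Optimality allows `Δ` of order `T^(δ-1)` and `M = T^(α'+1-δ)` with `α'` slightly above `α`, so the
exponent is of order `T^(α'+δ-1)`. Consistency allows `Δ = 1/2` and `M = S^β'`, with exponent of
order `S^β'`. A fixed-time policy needs `S = T`; an any-time policy can be stopped at `S ≈ T^δ`,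
which already yields regret of order `T^δ` and improves the exponent to `T^(δβ')`. -/

lemma lintegral_roundKernel (σ : ℝ≥0) (θ : Fin K → ℝ) (π : AnyTimePolicy K) (t : ℕ)
    (h : History K t) {f : Fin K × ℝ → ℝ≥0∞} (hf : Measurable f) :
    ∫⁻ p, f p ∂(roundKernel σ θ π t h) =
      ∫⁻ a, ∫⁻ x, f (a, x) ∂(gaussianReal (θ a) (σ ^ 2)) ∂(π.act t h) := by
  rw [roundKernel, Kernel.lintegral_compProd _ _ _ hf]
  rfl

lemma lintegral_historyLaw_succ (σ : ℝ≥0) (θ : Fin K → ℝ) (π : AnyTimePolicy K) (t : ℕ)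
    {f : History K (t + 1) → ℝ≥0∞} (hf : Measurable f) :
    ∫⁻ h, f h ∂(historyLaw σ θ π (t + 1)) =
      ∫⁻ h, ∫⁻ p, f (Fin.snoc h p) ∂(roundKernel σ θ π t h) ∂(historyLaw σ θ π t) := by
  rw [historyLaw, lintegral_map hf (measurable_snoc t),
    Measure.lintegral_compProd (f := fun p => f (Fin.snoc p.1 p.2)) (hf.comp (measurable_snoc t))]

/-! ### Change of measure -/

/-- The logarithm of the likelihood ratio of the mean vectors `θ'` and `θ` for one round. -/
noncomputable def roundLogRatio (σ : ℝ≥0) (θ θ' : Fin K → ℝ) (p : Fin K × ℝ) : ℝ :=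
  ((θ' p.1 - θ p.1) * (p.2 - θ p.1) - (θ' p.1 - θ p.1) ^ 2 / 2) / (σ : ℝ) ^ 2

/-- The logarithm of the likelihood ratio of the mean vectors `θ'` and `θ` for a history. -/
noncomputable def logRatio (σ : ℝ≥0) (θ θ' : Fin K → ℝ) {t : ℕ} (h : History K t) : ℝ :=
  ∑ i, roundLogRatio σ θ θ' (h i)

@[fun_prop]
lemma measurable_roundLogRatio (σ : ℝ≥0) (θ θ' : Fin K → ℝ) :
    Measurable (roundLogRatio σ θ θ') := by
  have h (g : Fin K → ℝ) : Measurable fun p : Fin K × ℝ => g p.1 :=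
    (measurable_from_top (f := g)).comp measurable_fst
  unfold roundLogRatio
  exact ((((h θ').sub (h θ)).mul (measurable_snd.sub (h θ))).sub
    ((((h θ').sub (h θ)).pow_const 2).div_const 2)).div_const _

@[fun_prop]
lemma measurable_logRatio (σ : ℝ≥0) (θ θ' : Fin K → ℝ) (t : ℕ) :
    Measurable (logRatio σ θ θ' : History K t → ℝ) := by
  unfold logRatio
  exact Finset.measurable_sum _ fun i _ =>
    (measurable_roundLogRatio σ θ θ').comp (measurable_pi_apply i)

lemma logRatio_snoc (σ : ℝ≥0) (θ θ' : Fin K → ℝ) {t : ℕ} (h : History K t) (p : Fin K × ℝ) :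
    logRatio σ θ θ' (Fin.snoc h p : History K (t + 1)) =
      logRatio σ θ θ' h + roundLogRatio σ θ θ' p := by
  simp [logRatio, Fin.sum_univ_castSucc]

lemma lintegral_gaussianReal_eq {v : ℝ≥0} (hv : v ≠ 0) (m m' : ℝ) {f : ℝ → ℝ≥0∞}
    (hf : Measurable f) :
    ∫⁻ x, f x ∂(gaussianReal m' v) =
      ∫⁻ x, ENNReal.ofReal (Real.exp (((m' - m) * (x - m) - (m' - m) ^ 2 / 2) / v)) * f x
        ∂(gaussianReal m v) := by
  have hv' : (v : ℝ) ≠ 0 := by exact_mod_cast hv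
  rw [gaussianReal_of_var_ne_zero _ hv, gaussianReal_of_var_ne_zero _ hv,
    lintegral_withDensity_eq_lintegral_mul _ (measurable_gaussianPDF _ _) hf,
    lintegral_withDensity_eq_lintegral_mul _ (measurable_gaussianPDF _ _) (by fun_prop)]
  refine lintegral_congr fun x => ?_
  simp only [Pi.mul_apply, gaussianPDF, ← mul_assoc]
  rw [← ENNReal.ofReal_mul (gaussianPDFReal_nonneg _ _ _)]
  congr 2
  simp only [gaussianPDFReal]
  rw [mul_assoc (√_)⁻¹, ← Real.exp_add]
  congr 2
  field_simp
  ring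

/-- Both laws use the same arm-selection kernels, so only the Gaussian reward densities contribute
to the likelihood ratio. -/
lemma lintegral_historyLaw_eq {σ : ℝ≥0} (hσ : 0 < σ) (θ θ' : Fin K → ℝ) (π : AnyTimePolicy K)
    (t : ℕ) {f : History K t → ℝ≥0∞} (hf : Measurable f) :
    ∫⁻ h, f h ∂(historyLaw σ θ' π t) =
      ∫⁻ h, ENNReal.ofReal (Real.exp (logRatio σ θ θ' h)) * f h ∂(historyLaw σ θ π t) := by
  induction t with
  | zero => simp [historyLaw, logRatio]
  | succ t ih =>
    have hm := measurable_snoc (K := K) t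
    have hL : Measurable fun h : History K (t + 1) =>
        ENNReal.ofReal (Real.exp (logRatio σ θ θ' h)) * f h := by fun_prop
    rw [lintegral_historyLaw_succ _ _ _ _ hf, lintegral_historyLaw_succ _ _ _ _ hL,
      ih (Measurable.lintegral_kernel_prod_right
        (f := fun h p => f (Fin.snoc h p)) (hf.comp hm))]
    refine lintegral_congr fun h => ?_
    have hmh : Measurable fun p : Fin K × ℝ => (Fin.snoc h p : History K (t + 1)) :=
      hm.comp measurable_prodMk_left
    rw [lintegral_roundKernel _ _ _ _ _ (f := fun p => f (Fin.snoc h p)) (hf.comp hmh),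
      lintegral_roundKernel _ _ _ _ _ (f := fun p => ENNReal.ofReal
        (Real.exp (logRatio σ θ θ' (Fin.snoc h p : History K (t + 1)))) * f (Fin.snoc h p))
        (hL.comp hmh),
      ← lintegral_const_mul _ measurable_from_top]
    refine lintegral_congr fun a => ?_
    have hma : Measurable fun x : ℝ => f (Fin.snoc h (a, x)) :=
      hf.comp (hmh.comp measurable_prodMk_left)
    rw [lintegral_gaussianReal_eq (pow_ne_zero 2 hσ.ne') (θ a) (θ' a) hma,
      ← lintegral_const_mul _ (by fun_prop)]
    refine lintegral_congr fun x => ?_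
    rw [logRatio_snoc, Real.exp_add, ENNReal.ofReal_mul (Real.exp_nonneg _), mul_assoc]
    simp [roundLogRatio]

/-- The shifts by `d` and `-d` have opposite linear terms and equal quadratic terms. Hence an
inverse likelihood ratio is again a likelihood ratio, up to a factor controlled by the pulls of `b`.
-/
lemma neg_logRatio (σ : ℝ≥0) (θ : Fin K → ℝ) (b : Fin K) (d : ℝ) {t : ℕ} (h : History K t) :
    -logRatio σ θ (θ + Pi.single b d) h =
      logRatio σ θ (θ - Pi.single b d) h + pulls h b * (d ^ 2 / (σ : ℝ) ^ 2) := by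
  have hp : (pulls h b : ℝ) * (d ^ 2 / (σ : ℝ) ^ 2) =
      ∑ i, if (h i).1 = b then d ^ 2 / (σ : ℝ) ^ 2 else 0 := by
    rw [← Finset.sum_filter, Finset.sum_const, pulls, nsmul_eq_mul]
  rw [hp, logRatio, logRatio, ← Finset.sum_add_distrib, ← Finset.sum_neg_distrib]
  refine Finset.sum_congr rfl fun i _ => ?_
  by_cases hb : (h i).1 = b
  · simp only [roundLogRatio, Pi.add_apply, Pi.sub_apply, hb, Pi.single_eq_same, if_true]
    ring
  · simp [roundLogRatio, hb]

lemma measurable_pulls (t : ℕ) (b : Fin K) :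
    Measurable fun h : History K t => (pulls h b : ℝ) := by
  have : (fun h : History K t => (pulls h b : ℝ)) =
      fun h => ∑ i, if (h i).1 = b then (1 : ℝ) else 0 := by
    ext h
    simp [pulls]
  rw [this]
  exact Finset.measurable_sum _ fun i _ =>
    (measurable_from_top (f := fun a : Fin K => if a = b then (1 : ℝ) else 0)).comp
      (measurable_fst.comp (measurable_pi_apply i))

/-- Raising the mean of arm `b` by `d` lowers the probability that arm `b` is pulled at most `M`
times in a controlled way. -/
lemma sq_historyLaw_le {σ : ℝ≥0} (hσ : 0 < σ) (θ : Fin K → ℝ) (b : Fin K) (d M : ℝ)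
    (π : AnyTimePolicy K) (t : ℕ) :
    historyLaw σ θ π t {h | (pulls h b : ℝ) ≤ M} ^ 2 ≤
      historyLaw σ (θ + Pi.single b d) π t {h | (pulls h b : ℝ) ≤ M} *
        ENNReal.ofReal (Real.exp (M * (d ^ 2 / (σ : ℝ) ^ 2))) := by
  set A : Set (History K t) := {h | (pulls h b : ℝ) ≤ M} with hA
  have hAm : MeasurableSet A := measurableSet_le (measurable_pulls t b) measurable_const
  set θ' := θ + Pi.single b d with hθ'
  set u : History K t → ℝ≥0∞ := fun h => ENNReal.ofReal (Real.exp (logRatio σ θ θ' h / 2)) with hu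
  set v : History K t → ℝ≥0∞ :=
    A.indicator fun h => ENNReal.ofReal (Real.exp (-(logRatio σ θ θ' h / 2))) with hv
  have hum : Measurable u := by fun_prop
  have hvm : Measurable v := Measurable.indicator (by fun_prop) hAm
  set w : History K t → ℝ≥0∞ := A.indicator 1 with hw
  have hone : Measurable w := measurable_one.indicator hAm
  -- Cauchy–Schwarz for `1_A = (L^(1/2) 1_A) (L^(-1/2) 1_A)`, with `L` the likelihood ratio of `θ'`
  -- to `θ`.
  have key := ENNReal.lintegral_mul_le_Lp_mul_Lq (historyLaw σ θ π t) Real.HolderConjugate.two_two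
    (hum.mul hone).aemeasurable hvm.aemeasurable
  have h1 : ∫⁻ h, ((u * w) * v) h ∂(historyLaw σ θ π t) = historyLaw σ θ π t A := by
    rw [← lintegral_indicator_one hAm]
    refine lintegral_congr fun h => ?_
    by_cases hh : h ∈ A
    · simp [hu, hv, hw, hh, ← ENNReal.ofReal_mul (Real.exp_nonneg _), ← Real.exp_add]
    · simp [hv, hw, hh]
  have h2 : ∫⁻ h, (u * w) h ^ (2 : ℝ) ∂(historyLaw σ θ π t) =
      historyLaw σ θ' π t A := by
    rw [← lintegral_indicator_one hAm, lintegral_historyLaw_eq hσ θ θ' π t hone]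
    refine lintegral_congr fun h => ?_
    by_cases hh : h ∈ A
    · simp [hu, hw, hh, pow_two, ← ENNReal.ofReal_mul (Real.exp_nonneg _), ← Real.exp_add]
    · simp [hw, hh]
  have h3 : ∫⁻ h, v h ^ (2 : ℝ) ∂(historyLaw σ θ π t) ≤
      ENNReal.ofReal (Real.exp (M * (d ^ 2 / (σ : ℝ) ^ 2))) := by
    -- The likelihood ratio of the reflected vector `θ - d e_b` has integral 1, so only the factor
    -- from the at most `M` pulls of `b` remains.
    have hlaw := lintegral_historyLaw_eq hσ θ (θ - Pi.single b d) π t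
      (f := fun _ => 1) measurable_const
    simp only [mul_one, lintegral_const, measure_univ] at hlaw
    calc ∫⁻ h, v h ^ (2 : ℝ) ∂(historyLaw σ θ π t)
        ≤ ∫⁻ h, ENNReal.ofReal (Real.exp (M * (d ^ 2 / (σ : ℝ) ^ 2))) *
            ENNReal.ofReal (Real.exp (logRatio σ θ (θ - Pi.single b d) h))
              ∂(historyLaw σ θ π t) := by
          refine lintegral_mono fun h => ?_
          by_cases hh : h ∈ A
          · have hle : (pulls h b : ℝ) * (d ^ 2 / (σ : ℝ) ^ 2) ≤ M * (d ^ 2 / (σ : ℝ) ^ 2) :=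
              mul_le_mul_of_nonneg_right hh (by positivity)
            have hn := neg_logRatio σ θ b d h
            have hvh : v h = ENNReal.ofReal (Real.exp (-(logRatio σ θ θ' h / 2))) := by
              simp [hv, hh]
            rw [hvh, ENNReal.rpow_two, pow_two, ← ENNReal.ofReal_mul (Real.exp_nonneg _),
              ← ENNReal.ofReal_mul (Real.exp_nonneg _), ← Real.exp_add, ← Real.exp_add]
            refine ENNReal.ofReal_le_ofReal (Real.exp_le_exp.2 ?_)
            linarith
          · simp [hv, hh]
      _ = _ := by rw [lintegral_const_mul _ (by fun_prop), ← hlaw, mul_one]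
  rw [h1, h2] at key
  calc historyLaw σ θ π t A ^ 2
      ≤ ((historyLaw σ θ' π t A) ^ (1 / 2 : ℝ) *
          (ENNReal.ofReal (Real.exp (M * (d ^ 2 / (σ : ℝ) ^ 2)))) ^ (1 / 2 : ℝ)) ^ 2 := by
        gcongr
        exact key.trans (by gcongr)
    _ = _ := by
        rw [mul_pow, ← ENNReal.rpow_natCast, ← ENNReal.rpow_natCast, ← ENNReal.rpow_mul,
          ← ENNReal.rpow_mul]
        norm_num

/-! ### The pseudo regret -/

lemma sub_le_gap (θ : Fin K → ℝ) (j k : Fin K) : θ j - θ k ≤ gap θ k :=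
  sub_le_sub_right (le_ciSup (Set.finite_range θ).bddAbove j) _

lemma gap_nonneg (θ : Fin K → ℝ) (k : Fin K) : 0 ≤ gap θ k := by
  simpa using sub_le_gap θ k k

lemma sum_pulls {t : ℕ} (h : History K t) : ∑ k, pulls h k = t := by
  have := Finset.card_eq_sum_card_fiberwise (s := (Finset.univ : Finset (Fin t)))
    (t := (Finset.univ : Finset (Fin K))) (f := fun i => (h i).1) (by simp)
  simpa [pulls] using this.symm

lemma pulls_mul_gap_le (θ : Fin K → ℝ) {t : ℕ} (h : History K t) (b : Fin K) :
    pulls h b * gap θ b ≤ pseudoRegret θ h :=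
  Finset.single_le_sum (f := fun k => (pulls h k : ℝ) * gap θ k)
    (fun k _ => mul_nonneg (Nat.cast_nonneg _) (gap_nonneg θ k)) (Finset.mem_univ b)

lemma sub_pulls_mul_le (θ : Fin K → ℝ) {t : ℕ} (h : History K t) (b : Fin K) {Δ : ℝ}
    (hΔ : ∀ k, k ≠ b → Δ ≤ gap θ k) :
    ((t : ℝ) - pulls h b) * Δ ≤ pseudoRegret θ h := by
  have ht : (t : ℝ) = ∑ k, (pulls h k : ℝ) := by exact_mod_cast (sum_pulls h).symm
  rw [ht, pseudoRegret, ← Finset.add_sum_erase _ _ (Finset.mem_univ b),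
    ← Finset.add_sum_erase _ _ (Finset.mem_univ b), add_sub_cancel_left, Finset.sum_mul]
  have h0 : 0 ≤ (pulls h b : ℝ) * gap θ b := mul_nonneg (Nat.cast_nonneg _) (gap_nonneg θ b)
  have h1 : ∑ k ∈ Finset.univ.erase b, (pulls h k : ℝ) * Δ ≤
      ∑ k ∈ Finset.univ.erase b, (pulls h k : ℝ) * gap θ k :=
    Finset.sum_le_sum fun k hk =>
      mul_le_mul_of_nonneg_left (hΔ k (Finset.ne_of_mem_erase hk)) (Nat.cast_nonneg _)
  linarith

lemma measurable_pseudoRegret (θ : Fin K → ℝ) (t : ℕ) :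
    Measurable (pseudoRegret θ : History K t → ℝ) := by
  unfold pseudoRegret
  exact Finset.measurable_sum _ fun k _ => (measurable_pulls t k).mul_const _

lemma pulls_le_pulls_snoc {t : ℕ} (h : History K t) (p : Fin K × ℝ) (k : Fin K) :
    pulls h k ≤ pulls (Fin.snoc h p : History K (t + 1)) k := by
  simp only [pulls, Finset.card_filter, Fin.sum_univ_castSucc, Fin.snoc_castSucc]
  exact Nat.le_add_right _ _

lemma pseudoRegret_le_snoc (θ : Fin K → ℝ) {t : ℕ} (h : History K t) (p : Fin K × ℝ) :
    pseudoRegret θ h ≤ pseudoRegret θ (Fin.snoc h p : History K (t + 1)) :=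
  Finset.sum_le_sum fun k _ => mul_le_mul_of_nonneg_right
    (Nat.cast_le.2 (pulls_le_pulls_snoc h p k)) (gap_nonneg θ k)

/-- The pseudo regret stochastically increases with the horizon. -/
lemma historyLaw_lt_pseudoRegret_mono (σ : ℝ≥0) (θ : Fin K → ℝ) (π : AnyTimePolicy K) (x : ℝ) :
    Monotone fun t => historyLaw σ θ π t {h | x < pseudoRegret θ h} := by
  refine monotone_nat_of_le_succ fun t => ?_
  have hm (s : ℕ) : MeasurableSet {h : History K s | x < pseudoRegret θ h} :=
    measurableSet_lt measurable_const (measurable_pseudoRegret θ s)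
  rw [← lintegral_indicator_one (hm t), ← lintegral_indicator_one (hm (t + 1)),
    lintegral_historyLaw_succ _ _ _ _ (measurable_one.indicator (hm (t + 1)))]
  refine lintegral_mono fun h => ?_
  by_cases hx : x < pseudoRegret θ h
  · have (p : Fin K × ℝ) : x < pseudoRegret θ (Fin.snoc h p : History K (t + 1)) :=
      hx.trans_le (pseudoRegret_le_snoc θ h p)
    simp [Set.indicator, hx, this]
  · simp [Set.indicator, hx]

/-! ### A lower bound for the tail -/

/-- If the regret of a policy is small when arm `a` leads by `Δ`, then its regret is large with
non-negligible probability once the mean of arm `b` is raised by `2Δ`. -/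
lemma le_historyLaw_lt_pseudoRegret {σ : ℝ≥0} (hσ : 0 < σ) (π : AnyTimePolicy K) {a b : Fin K}
    (hab : a ≠ b) {Δ M x : ℝ} (hΔ : 0 < Δ) (hM : 0 < M) {S T : ℕ} (hST : S ≤ T)
    (hR : ∫⁻ h, ENNReal.ofReal (pseudoRegret (Pi.single a Δ) h)
      ∂(historyLaw σ (Pi.single a Δ) π S) ≤ ENNReal.ofReal (M * Δ / 2))
    (hx : x < (S - M) * Δ) :
    ENNReal.ofReal (1 / 4 * Real.exp (-(M * ((2 * Δ) ^ 2 / (σ : ℝ) ^ 2)))) ≤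
      historyLaw σ (Pi.single a Δ + Pi.single b (2 * Δ)) π T
        {h | x < pseudoRegret (Pi.single a Δ + Pi.single b (2 * Δ)) h} := by
  set θ : Fin K → ℝ := Pi.single a Δ with hθ
  set θ' : Fin K → ℝ := θ + Pi.single b (2 * Δ) with hθ'
  set A : Set (History K S) := {h | (pulls h b : ℝ) ≤ M} with hA
  set D : ℝ := M * ((2 * Δ) ^ 2 / (σ : ℝ) ^ 2) with hD
  have hAm : MeasurableSet A := measurableSet_le (measurable_pulls S b) measurable_const
  have hgap : Δ ≤ gap θ b := by
    simpa [hθ, hab.symm] using sub_le_gap θ a b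
  have hgap' : ∀ k, k ≠ b → Δ ≤ gap θ' k := by
    intro k hk
    have h1 := sub_le_gap θ' b k
    have h2 : θ' b = 2 * Δ := by simp [hθ', hθ, hab.symm]
    have h3 : θ' k ≤ Δ := by
      by_cases hka : k = a
      · subst hka; simp [hθ', hθ, hk]
      · simp [hθ', hθ, hk, hka, hΔ.le]
    linarith
  -- Markov's inequality: more than `M` pulls of `b` cost at least `MΔ`, twice the bound on the
  -- expected regret.
  have hAc : historyLaw σ θ π S Aᶜ ≤ ENNReal.ofReal (1 / 2) := by
    have hmk := mul_meas_ge_le_lintegral (μ := historyLaw σ θ π S)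
      (ENNReal.measurable_ofReal.comp (measurable_pseudoRegret θ S)) (ENNReal.ofReal (M * Δ))
    have hsub : Aᶜ ⊆ {h | ENNReal.ofReal (M * Δ) ≤
        (ENNReal.ofReal ∘ (pseudoRegret θ : History K S → ℝ)) h} := by
      intro h hh
      have hlt : M < pulls h b := not_le.1 hh
      refine ENNReal.ofReal_le_ofReal ((mul_le_mul hlt.le hgap hΔ.le (Nat.cast_nonneg _)).trans ?_)
      exact pulls_mul_gap_le θ h b
    have hpos : 0 < M * Δ := mul_pos hM hΔ
    have h5 : ENNReal.ofReal (M * Δ) * historyLaw σ θ π S Aᶜ ≤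
        ENNReal.ofReal (M * Δ) * ENNReal.ofReal (1 / 2) := by
      rw [← ENNReal.ofReal_mul hpos.le, mul_one_div]
      exact ((mul_le_mul_right (measure_mono hsub) _).trans hmk).trans hR
    exact (ENNReal.mul_le_mul_iff_right (by simpa using hpos) ENNReal.ofReal_ne_top).1 h5
  have hAge : ENNReal.ofReal (1 / 2) ≤ historyLaw σ θ π S A := by
    have h1 := prob_add_prob_compl (μ := historyLaw σ θ π S) hAm
    have h2 : (1 : ℝ≥0∞) = ENNReal.ofReal (1 / 2) + ENNReal.ofReal (1 / 2) := by
      rw [← ENNReal.ofReal_add] <;> norm_num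
    by_contra! hlt
    have := ENNReal.add_lt_add_of_lt_of_le (ne_top_of_le_ne_top ENNReal.ofReal_ne_top hAc) hlt hAc
    rw [h1, ← h2] at this
    exact lt_irrefl _ this
  have hsq := sq_historyLaw_le hσ θ b (2 * Δ) M π S
  have hlow : ENNReal.ofReal (1 / 4 * Real.exp (-D)) ≤ historyLaw σ θ' π S A := by
    have h4 : ENNReal.ofReal (1 / 4 * Real.exp (-D)) * ENNReal.ofReal (Real.exp D) ≤
        historyLaw σ θ' π S A * ENNReal.ofReal (Real.exp D) := by
      refine le_trans (le_trans (le_of_eq ?_) (pow_le_pow_left₀ zero_le hAge 2)) hsq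
      rw [← ENNReal.ofReal_mul (by positivity), mul_assoc, ← Real.exp_add,
        ← ENNReal.ofReal_pow (by norm_num)]
      norm_num
    exact (ENNReal.mul_le_mul_iff_left (by simpa using Real.exp_pos D)
      ENNReal.ofReal_ne_top).1 h4
  refine hlow.trans (le_trans (measure_mono fun h hh => ?_)
    (historyLaw_lt_pseudoRegret_mono σ θ' π x hST))
  refine hx.trans_le (le_trans ?_ (sub_pulls_mul_le θ' h b hgap'))
  exact mul_le_mul_of_nonneg_right (sub_le_sub_left hh _) hΔ.le

/-! ### Rates -/

lemma eventually_const_mul_rpow_add_lt {r s : ℝ} (hrs : r < s) (hs : 0 < s) (a b : ℝ) {ε : ℝ}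
    (hε : 0 < ε) : ∀ᶠ x : ℝ in atTop, a * x ^ r + b < ε * x ^ s := by
  have h1 : Tendsto (fun x : ℝ => a * x ^ (-(s - r)) + b * x ^ (-s)) atTop (nhds (a * 0 + b * 0)) :=
    ((tendsto_rpow_neg_atTop (sub_pos.2 hrs)).const_mul a).add
      ((tendsto_rpow_neg_atTop hs).const_mul b)
  have h2 := h1.eventually_lt_const (u := ε) (by simpa using hε)
  filter_upwards [h2, eventually_gt_atTop 0] with x hx hx0
  have h3 := mul_lt_mul_of_pos_right hx (Real.rpow_pos_of_pos hx0 s)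
  rw [add_mul, mul_assoc, mul_assoc, ← Real.rpow_add hx0, ← Real.rpow_add hx0] at h3
  simpa using h3

/-- A sequence of probabilities that decays at most like `exp (-k T ^ r)` does not decay like
`exp (-C T ^ γ)` with `r < γ`. -/
lemma not_limsup_log_div_rpow_le {p : ℕ → ℝ≥0∞} {k r γ C : ℝ} (hr : r < γ) (hγ : 0 < γ)
    (hC : 0 < C)
    (hp : ∀ᶠ T : ℕ in atTop, ENNReal.ofReal (1 / 4 * Real.exp (-(k * (T : ℝ) ^ r))) ≤ p T) :
    ¬ limsup (fun T : ℕ => ENNReal.log (p T) / (((T : ℝ) ^ γ : ℝ) : EReal)) atTop ≤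
      ((-C : ℝ) : EReal) := by
  intro hle
  have hlt := eventually_lt_of_limsup_lt
    (hle.trans_lt (EReal.coe_lt_coe_iff.2 (by linarith : -C < -(C / 2))))
  have hrate := tendsto_natCast_atTop_atTop.eventually
    (eventually_const_mul_rpow_add_lt hr hγ k (-Real.log (1 / 4)) (half_pos hC))
  obtain ⟨T, h1, h2, h3, h4⟩ :=
    (hlt.and (hrate.and (hp.and (eventually_gt_atTop 0)))).exists
  have hT : 0 < (T : ℝ) ^ γ := Real.rpow_pos_of_pos (Nat.cast_pos.2 h4) _
  rw [EReal.div_lt_iff (EReal.coe_pos.2 hT) (EReal.coe_ne_top _)] at h1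
  have h5 := (ENNReal.log_le_log h3).trans_lt h1
  rw [ENNReal.log_ofReal_of_pos (by positivity), ← EReal.coe_mul, EReal.coe_lt_coe_iff,
    Real.log_mul (by norm_num) (Real.exp_ne_zero _), Real.log_exp] at h5
  linarith

lemma eventually_le_of_limsup_div_rpow_eq_zero {E : ℕ → ℝ≥0∞} {r : ℝ}
    (h : limsup (fun T : ℕ => E T / (T : ℝ≥0∞) ^ r) atTop = 0) {ε : ℝ} (hε : 0 < ε) :
    ∀ᶠ T : ℕ in atTop, E T ≤ ENNReal.ofReal (ε * (T : ℝ) ^ r) := by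
  have hlt := eventually_lt_of_limsup_lt (h.trans_lt (ENNReal.ofReal_pos.2 hε))
  filter_upwards [hlt, eventually_gt_atTop 0] with T h1 h2
  have hT : (0 : ℝ) < T := Nat.cast_pos.2 h2
  have h3 : (T : ℝ≥0∞) ^ r = ENNReal.ofReal ((T : ℝ) ^ r) := by
    rw [← ENNReal.ofReal_rpow_of_pos hT, ENNReal.ofReal_natCast]
  rw [h3] at h1
  rw [ENNReal.ofReal_mul hε.le]
  exact (ENNReal.div_le_iff (by simpa using Real.rpow_pos_of_pos hT r) ENNReal.ofReal_ne_top).1 h1.le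

/-! ### Choice of instances and the resulting obstructions -/

lemma single_mem_meanVectors (a : Fin K) {Δ : ℝ} (h0 : 0 ≤ Δ) (h1 : Δ ≤ 1) :
    Pi.single a Δ ∈ meanVectors K := by
  constructor <;> intro k <;> by_cases hk : k = a
  · subst hk; simpa
  · simp [hk]
  · subst hk; simpa
  · simp [hk]

lemma single_add_single_mem_meanVectors {a b : Fin K} (hab : a ≠ b) {Δ : ℝ} (h0 : 0 ≤ Δ)
    (h1 : Δ ≤ 1 / 2) :
    Pi.single a Δ + Pi.single b (2 * Δ) ∈ meanVectors K := by
  constructor <;> intro k <;> by_cases hk : k = a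
  · subst hk; simp [hab, h0]
  · by_cases hb : k = b
    · subst hb; simp [hk, h0]
    · simp [hk, hb]
  · subst hk; simp [hab]; linarith
  · by_cases hb : k = b
    · subst hb; simp [hk]; linarith
    · simp [hk, hb]

/-- Transfers the consistency obstruction to worst-case tails, which gives the second entry of each
minimum. -/
lemma IsWorstCaseTailed.isInstanceTailed {σ : ℝ≥0} {π : FixedTimePolicy K} {δ γ : ℝ}
    (h : IsWorstCaseTailed σ π δ γ) : IsInstanceTailed σ π δ γ := by
  obtain ⟨c, C, hc, hc', hC, hle⟩ := h
  refine fun θ hθ => ⟨c, C, hc, hc', hC, le_trans (limsup_le_limsup (.of_forall fun T => ?_)) hle⟩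
  refine EReal.div_le_div_right_of_nonneg (EReal.coe_nonneg.2 (by positivity)) ?_
  exact ENNReal.log_le_log (le_iSup₂ (f := fun θ _ => tailProb σ θ π T (c * (T : ℝ) ^ δ)) θ hθ)

/-- A worst-case optimal policy cannot have light worst-case tails. -/
lemma IsOptimal.not_isWorstCaseTailed (hK : 2 ≤ K) {σ : ℝ≥0} (hσ : 0 < σ)
    {π : FixedTimePolicy K} {α δ γ : ℝ} (hα : 1 / 2 ≤ α) (hπ : IsOptimal σ π α)
    (hδ : α < δ) (hδ' : δ ≤ 1) (hγ : δ + α - 1 < γ) : ¬ IsWorstCaseTailed σ π δ γ := by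
  rintro ⟨c, C, hc, hc', hC, hle⟩
  -- `α' < δ` makes `MΔ` negligible against `T^δ`; the other bound puts the exponent `α' + δ - 1`
  -- below `γ`.
  obtain ⟨α', h1, h2⟩ := exists_between (lt_min hδ (by linarith : α < γ + 1 - δ))
  obtain ⟨h2, h3⟩ := lt_min_iff.1 h2
  let a : Fin K := ⟨0, by omega⟩
  let b : Fin K := ⟨1, by omega⟩
  have hab : a ≠ b := by simp [a, b]
  refine not_limsup_log_div_rpow_le (k := 1 / (σ : ℝ) ^ 2) (r := α' + δ - 1)
    (by linarith) (by linarith) hC ?_ hle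
  -- Since `(T - M)Δ = T^δ/2 - T^α'/2`, any `c < 1/2` leaves room for the loss.
  have hrate := tendsto_natCast_atTop_atTop.eventually
    (eventually_const_mul_rpow_add_lt h2 (by linarith) (1 / 2) 0 (sub_pos.2 hc'))
  filter_upwards [hrate, eventually_le_of_limsup_div_rpow_eq_zero (hπ α' h1)
    (by norm_num : (0 : ℝ) < 1 / 4), eventually_ge_atTop 1] with T hT1 hT2 hT3
  have hT : (1 : ℝ) ≤ T := by exact_mod_cast hT3
  have hT0 : (0 : ℝ) < T := by linarith
  set Δ : ℝ := (T : ℝ) ^ (δ - 1) / 2 with hΔ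
  set M : ℝ := (T : ℝ) ^ (α' + 1 - δ) with hM
  have hΔ0 : 0 < Δ := by positivity
  have hΔ1 : Δ ≤ 1 / 2 := by
    have := Real.rpow_le_one_of_one_le_of_nonpos hT (by linarith : δ - 1 ≤ 0)
    linarith
  have hMΔ : M * Δ = (T : ℝ) ^ α' / 2 := by
    rw [hM, hΔ, ← mul_div_assoc, ← Real.rpow_add hT0]; ring_nf
  have hTΔ : T * Δ = (T : ℝ) ^ δ / 2 := by
    rw [hΔ, ← mul_div_assoc, ← Real.rpow_one_add' hT0.le (by linarith)]; ring_nf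
  have hcost : M * ((2 * Δ) ^ 2 / (σ : ℝ) ^ 2) = 1 / (σ : ℝ) ^ 2 * (T : ℝ) ^ (α' + δ - 1) := by
    have : (T : ℝ) ^ (α' + δ - 1) = (T : ℝ) ^ (α' + 1 - δ) * ((T : ℝ) ^ (δ - 1)) ^ 2 := by
      rw [← Real.rpow_natCast, ← Real.rpow_mul hT0.le, ← Real.rpow_add hT0]
      congr 1; push_cast; ring
    rw [this, hM, hΔ]; ring
  have hlow := le_historyLaw_lt_pseudoRegret (x := c * (T : ℝ) ^ δ) hσ (π T) hab hΔ0
    (by positivity : 0 < M) le_rfl ?_ (by rw [sub_mul, hMΔ, hTΔ]; linarith)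
  · rw [← hcost]
    exact hlow.trans (le_iSup₂ (f := fun θ _ => tailProb σ θ π T (c * (T : ℝ) ^ δ)) _
      (single_add_single_mem_meanVectors hab hΔ0.le hΔ1))
  · rw [hMΔ, show (T : ℝ) ^ α' / 2 / 2 = 1 / 4 * (T : ℝ) ^ α' by ring]
    exact (le_iSup₂ (f := fun θ _ => expectedRegret σ θ π T) _
      (single_mem_meanVectors a hΔ0.le (by linarith))).trans hT2

/-- A consistent policy cannot have light instance-dependent tails. The times `S T` are earlier
times at which the sub-policy for the horizon `T` is as good as the one for the horizon `S T`. -/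
lemma IsConsistent.not_isInstanceTailed (hK : 2 ≤ K) {σ : ℝ≥0} (hσ : 0 < σ)
    {π : FixedTimePolicy K} {β δ γ ρ : ℝ} (hβ : 0 ≤ β) (hβ' : β < 1) (hπ : IsConsistent σ π β)
    (hδ : 0 < δ) (hρ : 0 < ρ) (hγ : ρ * β < γ) (S : ℕ → ℕ)
    (hST : ∀ᶠ T : ℕ in atTop, S T ≤ T ∧ (T : ℝ) ^ δ ≤ S T ∧ (S T : ℝ) ≤ 2 * (T : ℝ) ^ ρ)
    (hS : ∀ T, π (S T) = π T) : ¬ IsInstanceTailed σ π δ γ := by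
  intro h
  let a : Fin K := ⟨0, by omega⟩
  let b : Fin K := ⟨1, by omega⟩
  have hab : a ≠ b := by simp [a, b]
  obtain ⟨c, C, hc, hc', hC, hle⟩ := h _
    (single_add_single_mem_meanVectors (Δ := 1 / 2) hab (by norm_num) le_rfl)
  -- `β' < 1` makes `M = S^β'` negligible against `S`; `ρβ' < γ` makes the cost `S^β'` negligible
  -- against `T^γ`.
  obtain ⟨β', h1, h2⟩ := exists_between (lt_min hβ' ((lt_div_iff₀' hρ).2 hγ))
  obtain ⟨h2, h3⟩ := lt_min_iff.1 h2
  rw [lt_div_iff₀' hρ] at h3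
  have hStop : Tendsto S atTop atTop := by
    rw [← tendsto_natCast_atTop_iff (R := ℝ)]
    exact tendsto_atTop_mono' _ (hST.mono fun T hT => hT.2.1)
      ((tendsto_rpow_atTop hδ).comp tendsto_natCast_atTop_atTop)
  have hγ0 : 0 < γ := lt_of_le_of_lt (mul_nonneg hρ.le hβ) hγ
  refine not_limsup_log_div_rpow_le (k := 2 ^ β' / (σ : ℝ) ^ 2) (r := ρ * β') h3 hγ0 hC ?_ hle
  have hrate := (tendsto_natCast_atTop_atTop.comp hStop).eventually
    (eventually_const_mul_rpow_add_lt h2 one_pos (1 / 2) 0 (sub_pos.2 hc'))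
  -- Consistency is used at horizon `S T`, hence for the policy `π (S T)`, which `hS` identifies
  -- with `π T`.
  have hreg := hStop.eventually (eventually_le_of_limsup_div_rpow_eq_zero
    (hπ _ (single_mem_meanVectors a (Δ := 1 / 2) (by norm_num) (by norm_num)) β' h1)
    (by norm_num : (0 : ℝ) < 1 / 4))
  filter_upwards [hrate, hreg, hST, hStop.eventually_gt_atTop 0] with T hT1 hT2 hT3 hT4
  obtain ⟨hT5, hT6, hT7⟩ := hT3
  have hS0 : (0 : ℝ) < S T := Nat.cast_pos.2 hT4
  have hcost : (S T : ℝ) ^ β' * ((2 * (1 / 2)) ^ 2 / (σ : ℝ) ^ 2) ≤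
      2 ^ β' / (σ : ℝ) ^ 2 * (T : ℝ) ^ (ρ * β') := by
    have h4 := Real.rpow_le_rpow hS0.le hT7 (by linarith : 0 ≤ β')
    rw [Real.mul_rpow (by norm_num) (by positivity), ← Real.rpow_mul (Nat.cast_nonneg _)] at h4
    calc (S T : ℝ) ^ β' * ((2 * (1 / 2)) ^ 2 / (σ : ℝ) ^ 2) = (S T : ℝ) ^ β' / (σ : ℝ) ^ 2 := by
          ring
      _ ≤ 2 ^ β' * (T : ℝ) ^ (ρ * β') / (σ : ℝ) ^ 2 := by gcongr
      _ = _ := by ring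
  have hlow := le_historyLaw_lt_pseudoRegret (x := c * (T : ℝ) ^ δ) hσ (π T) hab
    (by norm_num : (0 : ℝ) < 1 / 2) (Real.rpow_pos_of_pos hS0 β') hT5 ?_ ?_
  · refine le_trans (ENNReal.ofReal_le_ofReal ?_) hlow
    gcongr
  · rw [show (S T : ℝ) ^ β' * (1 / 2) / 2 = 1 / 4 * (S T : ℝ) ^ β' by ring, ← hS T]
    exact hT2
  · have h5 := mul_le_mul_of_nonneg_left hT6 hc.le
    simp only [Function.comp_apply, Real.rpow_one] at hT1
    linarith

end Bandit

theorem mainTheorem4 (K : ℕ) (hK : 2 ≤ K) (σ : ℝ≥0) (hσ : 0 < σ)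
    (α β : ℝ) (hα : α ∈ Set.Ico (1 / 2 : ℝ) 1) (hβ : β ∈ Set.Ico (0 : ℝ) 1) :
    (∀ π : Bandit.FixedTimePolicy K,
      Bandit.IsOptimal σ π α → Bandit.IsConsistent σ π β →
        (∀ δ γ : ℝ, α < δ → δ ≤ 1 → min (δ + α - 1) β < γ →
          ¬ Bandit.IsWorstCaseTailed σ π δ γ) ∧
        (∀ δ γ : ℝ, β < δ → δ ≤ 1 → β < γ →
          ¬ Bandit.IsInstanceTailed σ π δ γ)) ∧
    (∀ π : Bandit.AnyTimePolicy K,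
      Bandit.IsOptimal σ π.toFixedTime α → Bandit.IsConsistent σ π.toFixedTime β →
        (∀ δ γ : ℝ, α < δ → δ ≤ 1 → min (δ + α - 1) (δ * β) < γ →
          ¬ Bandit.IsWorstCaseTailed σ π.toFixedTime δ γ) ∧
        (∀ δ γ : ℝ, β < δ → δ ≤ 1 → δ * β < γ →
          ¬ Bandit.IsInstanceTailed σ π.toFixedTime δ γ)) := by
  obtain ⟨hα, -⟩ := hα
  obtain ⟨hβ, hβ'⟩ := hβ
  have hfixed (π : Bandit.FixedTimePolicy K) (hπ : Bandit.IsConsistent σ π β) (δ γ : ℝ)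
      (hδ : 0 < δ) (hδ' : δ ≤ 1) (hγ : β < γ) : ¬ Bandit.IsInstanceTailed σ π δ γ := by
    refine hπ.not_isInstanceTailed hK hσ hβ hβ' hδ one_pos (by rwa [one_mul]) id ?_ fun T => rfl
    filter_upwards [eventually_ge_atTop 1] with T hT
    have hT' : (1 : ℝ) ≤ T := by exact_mod_cast hT
    refine ⟨le_rfl, ?_, ?_⟩
    · simpa using Real.rpow_le_rpow_of_exponent_le hT' hδ'
    · simp only [id, Real.rpow_one]; linarith
  have hany (π : Bandit.AnyTimePolicy K) (hπ : Bandit.IsConsistent σ π.toFixedTime β) (δ γ : ℝ)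
      (hδ : 0 < δ) (hδ' : δ ≤ 1) (hγ : δ * β < γ) :
      ¬ Bandit.IsInstanceTailed σ π.toFixedTime δ γ := by
    -- The sub-policy does not depend on the horizon, so it may be examined at the earlier time
    -- `⌈T^δ⌉`. The factor 2 in the bound on `S` absorbs the rounding.
    refine hπ.not_isInstanceTailed hK hσ hβ hβ' hδ hδ hγ (fun T => ⌈(T : ℝ) ^ δ⌉₊) ?_ fun T => rfl
    filter_upwards [eventually_ge_atTop 1] with T hT
    have hT' : (1 : ℝ) ≤ T := by exact_mod_cast hT
    refine ⟨Nat.ceil_le.2 (by simpa using Real.rpow_le_rpow_of_exponent_le hT' hδ'),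
      Nat.le_ceil _, ?_⟩
    have h1 := Nat.ceil_lt_add_one (by positivity : 0 ≤ (T : ℝ) ^ δ)
    have h2 := Real.one_le_rpow hT' hδ.le
    linarith
  refine ⟨fun π ho hc => ⟨fun δ γ h1 h2 h3 => ?_, fun δ γ h1 h2 h3 => ?_⟩,
    fun π ho hc => ⟨fun δ γ h1 h2 h3 => ?_, fun δ γ h1 h2 h3 => ?_⟩⟩
  · rcases min_lt_iff.1 h3 with h | h
    · exact ho.not_isWorstCaseTailed hK hσ hα h1 h2 h
    · exact fun hw => hfixed π hc δ γ (by linarith) h2 h hw.isInstanceTailed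
  · exact hfixed π hc δ γ (by linarith) h2 h3
  · rcases min_lt_iff.1 h3 with h | h
    · exact ho.not_isWorstCaseTailed hK hσ hα h1 h2 h
    · exact fun hw => hany π hc δ γ (by linarith) h2 h hw.isInstanceTailed
  · exact hany π hc δ γ (by linarith) h2 h3
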